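/- For an integer $n\ge 1$ and a real number $\xi$, let $\lambda_n(\xi)\in[-\infty,+\infty]$ be the supremum of the real numbers $\lambda$ such that, for arbitrarily large real numbers $X$, the inequalities $$0<|x_0|\le X,\qquad \max_{1\le m\le n}|x_0\xi^m-x_m|\le X^{-\lambda}$$ have a solution in integers $x_0,\dots,x_n$. The spectrum of $\lambda_n$ is the set of values taken by $\lambda_n$ on the set of transcendental real numbers. **Theorem.** For every integer $n\ge 1$, the spectrum of $\lambda_n$ includes the interval $$\left(\frac{3+\sqrt{4n^2+1}}{2n},\,+\infty\right],$$ that is, for every $\lambda$ in this interval (the value $+\infty$ included) there is a transcendental real number $\xi$ with $\lambda_n(\xi)=\lambda$. -/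

import Mathlib

noncomputable section

namespace SimultApprox

/-- `x = (x_0, …, x_n)` solves `0 < |x_0| ≤ X` and `max_{1 ≤ m ≤ n} |x_0 ξ^m - x_m| ≤ X^(-l)`. -/
def IsSolution (n : ℕ) (ξ l X : ℝ) (x : Fin (n + 1) → ℤ) : Prop :=
  0 < |(x 0 : ℝ)| ∧ |(x 0 : ℝ)| ≤ X ∧
    ∀ m : Fin n, |(x 0 : ℝ) * ξ ^ ((m : ℕ) + 1) - (x m.succ : ℝ)| ≤ X ^ (-l)

/-- The exponent `λ_n(ξ)`: the supremum, in the extended reals, of the real numbers `l` such that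
for arbitrarily large real `X` the system above has an integer solution. -/
def lambdaExp (n : ℕ) (ξ : ℝ) : EReal :=
  sSup {L : EReal | ∃ l : ℝ, L = (l : EReal) ∧
    ∀ X₀ : ℝ, ∃ X : ℝ, X₀ ≤ X ∧ ∃ x : Fin (n + 1) → ℤ, IsSolution n ξ l X x}

/-- The spectrum of `λ_n`: the set of its values at transcendental real numbers. -/
def lambdaSpectrum (n : ℕ) : Set EReal :=
  {L : EReal | ∃ ξ : ℝ, Transcendental ℚ ξ ∧ lambdaExp n ξ = L}

end SimultApprox

end

/-! Above the value 1, `λ_n` depends only on approximation of `ξ` by rationals. An approximation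
`p/q` of order `n (l + 1)` gives the integer point `(q^n, q^(n-1) p, …, p^n)` (`le_lambdaExp`).
Conversely, if `l > 1`, the errors of a good point are small even after multiplication by `x_0`;
this forces `q^n ∣ x_0`, with `q` the denominator of `x_1 / x_0` (`den_pow_dvd`), so `x_1 / x_0`
approximates `ξ` to order `n (l + 1)` in `q`. It remains to find transcendental numbers with
irrationality exponent exactly `c = n (l + 1) ≥ 3`. Lacunary ternary series with exponents growing
like powers of `c` have this exponent (`lacunary_approx`, `lacunary_rat_bound`), and the free choice
of digits 1 or 2 gives uncountably many of them, hence a transcendental one. Liouville numbers give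
the value `+∞`. -/

namespace SimultApprox

/-! ### Simultaneous approximation of powers versus rational approximation -/

/-- On a unit neighbourhood of `ξ`, the powers up to `n` share this Lipschitz constant. -/
noncomputable def powConst (n : ℕ) (ξ : ℝ) : ℝ := n * (|ξ| + 1) ^ n

lemma powConst_nonneg (n : ℕ) (ξ : ℝ) : 0 ≤ powConst n ξ := by
  unfold powConst; positivity

lemma abs_pow_sub_pow_le_powConst {n m : ℕ} (hm : m ≤ n) {ξ r : ℝ} (h : |ξ - r| ≤ 1) :
    |ξ ^ m - r ^ m| ≤ powConst n ξ * |ξ - r| := by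
  have hr : |r| ≤ |ξ| + 1 := by
    have := abs_sub_abs_le_abs_sub r ξ
    rw [abs_sub_comm] at this
    linarith
  have hmax : max |ξ| |r| ≤ |ξ| + 1 := max_le (by linarith) hr
  have h1 : (1 : ℝ) ≤ |ξ| + 1 := by linarith [abs_nonneg ξ]
  calc |ξ ^ m - r ^ m| ≤ |ξ - r| * m * max |ξ| |r| ^ (m - 1) := abs_pow_sub_pow_le ..
    _ ≤ |ξ - r| * n * (|ξ| + 1) ^ n := by
      gcongr
      exact (pow_le_pow_left₀ (by positivity) hmax _).trans
        (pow_le_pow_right₀ h1 (by omega))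
    _ = powConst n ξ * |ξ - r| := by unfold powConst; ring

/-- Rational approximations of order `n (l + 1)` to `ξ` force `λ_n(ξ) ≥ l`. -/
lemma le_lambdaExp {n : ℕ} (hn : 1 ≤ n) {ξ l K : ℝ} (hl : 0 < l)
    (H : ∀ Q : ℕ, ∃ q : ℕ, Q ≤ q ∧ ∃ p : ℤ,
      |ξ - p / q| ≤ K * (q : ℝ) ^ (-((n : ℝ) * (l + 1)))) :
    (l : EReal) ≤ lambdaExp n ξ := by
  have hK : 0 ≤ K := by
    obtain ⟨q, hq, p, hp⟩ := H 1
    have hq0 : (0 : ℝ) < q := by exact_mod_cast hq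
    by_contra! hK
    have := mul_neg_of_neg_of_pos hK (Real.rpow_pos_of_pos hq0 (-((n : ℝ) * (l + 1))))
    linarith [abs_nonneg (ξ - p / q)]
  have hnR : (1 : ℝ) ≤ n := by exact_mod_cast hn
  -- The room between `l'` and `l` absorbs the constants: `q^(n (l - l'))` eventually exceeds
  -- `powConst n ξ * K`.
  refine EReal.ge_of_forall_gt_iff_ge.1 fun l' hl' => ?_
  replace hl' : l' < l := by exact_mod_cast hl'
  refine le_sSup ⟨l', rfl, fun X₀ => ?_⟩
  have hev : ∀ᶠ q : ℕ in Filter.atTop, (powConst n ξ * K ≤ (q : ℝ) ^ (n * (l - l'))) ∧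
      K ≤ (q : ℝ) ^ (n * (l + 1)) ∧ X₀ ≤ q ∧ 1 ≤ q := by
    have t1 := (tendsto_rpow_atTop (y := n * (l - l'))
      (mul_pos (by linarith) (by linarith))).comp (tendsto_natCast_atTop_atTop (R := ℝ))
    have t2 := (tendsto_rpow_atTop (y := n * (l + 1))
      (mul_pos (by linarith) (by linarith))).comp (tendsto_natCast_atTop_atTop (R := ℝ))
    filter_upwards [t1.eventually_ge_atTop (powConst n ξ * K), t2.eventually_ge_atTop K,
      (tendsto_natCast_atTop_atTop (R := ℝ)).eventually_ge_atTop X₀,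
      Filter.eventually_ge_atTop 1] with q h1 h2 h3 h4 using ⟨h1, h2, h3, h4⟩
  obtain ⟨Q, hQ⟩ := Filter.eventually_atTop.1 hev
  obtain ⟨q, hq, p, hp⟩ := H Q
  obtain ⟨h1, h2, h3, h4⟩ := hQ q hq
  have hq1 : (1 : ℝ) ≤ q := by exact_mod_cast h4
  have hq0 : (0 : ℝ) < q := by linarith
  have hle1 : |ξ - p / q| ≤ 1 := by
    refine hp.trans ?_
    rw [Real.rpow_neg hq0.le, ← div_eq_mul_inv]
    exact div_le_one_of_le₀ h2 (by positivity)
  refine ⟨(q : ℝ) ^ n, h3.trans (le_self_pow₀ hq1 (by omega)),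
    fun m => (q : ℤ) ^ (n - m) * p ^ (m : ℕ), ?_, ?_, fun m => ?_⟩
  · simp; positivity
  · simp
  have hm : (m : ℕ) + 1 ≤ n := m.2
  have hx : ((q : ℝ) ^ (n - (m + 1)) * (p : ℝ) ^ ((m : ℕ) + 1)) =
      (q : ℝ) ^ n * (p / q) ^ ((m : ℕ) + 1) := by
    rw [div_pow]
    field_simp
    rw [mul_right_comm, ← pow_add, Nat.sub_add_cancel hm, mul_comm]
  have hpow : (q : ℝ) ^ n * (K * (q : ℝ) ^ (-((n : ℝ) * (l + 1)))) =
      K * (q : ℝ) ^ (-((n : ℝ) * l)) := by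
    rw [mul_left_comm, ← Real.rpow_natCast (q : ℝ) n, ← Real.rpow_add hq0]
    congr 2; ring
  simp only [Fin.val_zero, Nat.sub_zero, pow_zero, mul_one, Fin.val_succ]
  push_cast
  rw [hx, ← mul_sub, abs_mul, abs_of_pos (by positivity : (0 : ℝ) < (q : ℝ) ^ n)]
  calc (q : ℝ) ^ n * |ξ ^ ((m : ℕ) + 1) - (p / q) ^ ((m : ℕ) + 1)|
      ≤ (q : ℝ) ^ n * (powConst n ξ * (K * (q : ℝ) ^ (-((n : ℝ) * (l + 1))))) := by
        gcongr
        exact (abs_pow_sub_pow_le_powConst hm hle1).trans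
          (mul_le_mul_of_nonneg_left hp (powConst_nonneg n ξ))
    _ = (powConst n ξ * K) * (q : ℝ) ^ (-((n : ℝ) * l)) := by
        rw [mul_left_comm, hpow]; ring
    _ ≤ (q : ℝ) ^ (n * (l - l')) * (q : ℝ) ^ (-((n : ℝ) * l)) := by gcongr
    _ = ((q : ℝ) ^ n) ^ (-l') := by
        rw [← Real.rpow_add hq0, ← Real.rpow_natCast (q : ℝ) n, ← Real.rpow_mul hq0.le]
        congr 1; ring

/-- If `x` is close to a multiple of `(1, ξ, …, ξ^n)`, then `x_0` is divisible by the `n`-th power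
of the denominator of `x_1 / x_0`. -/
lemma den_pow_dvd {n : ℕ} {ξ ε : ℝ} {x : ℕ → ℤ} (hx0 : x 0 ≠ 0) (hε1 : ε ≤ 1)
    (hx : ∀ m, 1 ≤ m → m ≤ n → |(x 0 : ℝ) * ξ ^ m - x m| ≤ ε) (hn : 1 ≤ n)
    (hε : |(x 0 : ℝ)| * ((powConst n ξ + 1) * ε) < 1) :
    (((x 1 / x 0 : ℚ).den : ℤ)) ^ n ∣ x 0 := by
  set r : ℚ := (x 1 / x 0 : ℚ) with hr
  have hx0R : (x 0 : ℝ) ≠ 0 := by exact_mod_cast hx0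
  have hrR : (r : ℝ) = x 1 / x 0 := by rw [hr]; push_cast; rfl
  have hxabs : (1 : ℝ) ≤ |(x 0 : ℝ)| := by exact_mod_cast Int.one_le_abs hx0
  have hdist : |(x 0 : ℝ)| * |ξ - r| ≤ ε := by
    rw [← abs_mul, hrR]
    have := hx 1 le_rfl hn
    rwa [pow_one, show (x 0 : ℝ) * ξ - x 1 = x 0 * (ξ - x 1 / x 0) by field_simp] at this
  have hdist1 : |ξ - r| ≤ 1 := by nlinarith [abs_nonneg (ξ - r)]
  have hdvd1 : (r.den : ℤ) ∣ x 0 := by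
    have := Rat.den_dvd (x 1) (x 0)
    rwa [Rat.divInt_eq_div] at this
  have hdenle : (r.den : ℝ) ≤ |(x 0 : ℝ)| := by
    have := Int.le_of_dvd (abs_pos.2 hx0) ((dvd_abs _ _).2 hdvd1)
    exact_mod_cast this
  have hden0 : (r.den : ℝ) ≠ 0 := by exact_mod_cast r.den_nz
  -- Write `x_0 = den^(j+1) u`. Then `den (x_0 r^(j+2) - x_(j+2))` is an integer of absolute value
  -- below 1, so it vanishes; since `den` is coprime to `num`, it divides `u`.
  have key : ∀ j, j + 1 ≤ n → ((r.den : ℤ)) ^ (j + 1) ∣ x 0 := by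
    intro j
    induction j with
    | zero => intro _; simpa using hdvd1
    | succ j ih =>
      intro hj
      obtain ⟨u, hu⟩ := ih (by omega)
      have hb : |(x 0 : ℝ) * (r : ℝ) ^ (j + 2) - x (j + 2)| ≤ (powConst n ξ + 1) * ε := by
        have e : (x 0 : ℝ) * (r : ℝ) ^ (j + 2) - x (j + 2) =
          (x 0 * ξ ^ (j + 2) - x (j + 2)) - x 0 * (ξ ^ (j + 2) - r ^ (j + 2)) := by ring
        have h2 : |(x 0 : ℝ) * (ξ ^ (j + 2) - (r : ℝ) ^ (j + 2))| ≤ powConst n ξ * ε := by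
          rw [abs_mul]
          calc _ ≤ |(x 0 : ℝ)| * (powConst n ξ * |ξ - r|) := by
                gcongr; exact abs_pow_sub_pow_le_powConst hj hdist1
            _ = powConst n ξ * (|(x 0 : ℝ)| * |ξ - r|) := by ring
            _ ≤ _ := mul_le_mul_of_nonneg_left hdist (powConst_nonneg n ξ)
        rw [e]
        refine (abs_sub _ _).trans ?_
        linarith [hx (j + 2) (by omega) hj]
      have hint : (r.den : ℝ) * ((x 0 : ℝ) * (r : ℝ) ^ (j + 2) - x (j + 2)) =
          ((u * r.num ^ (j + 2) - r.den * x (j + 2) : ℤ) : ℝ) := by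
        have : (r : ℝ) = r.num / r.den := by exact_mod_cast (Rat.num_div_den r).symm
        rw [hu, this, div_pow]
        push_cast
        field_simp
        ring
      have hz : u * r.num ^ (j + 2) - r.den * x (j + 2) = 0 := by
        rw [← Int.abs_lt_one_iff]
        have : ((|u * r.num ^ (j + 2) - r.den * x (j + 2)| : ℤ) : ℝ) < 1 := by
          rw [Int.cast_abs, ← hint, abs_mul, Nat.abs_cast]
          refine lt_of_le_of_lt ?_ hε
          exact mul_le_mul hdenle hb (abs_nonneg _) (abs_nonneg _)
        exact_mod_cast this
      have hd : (r.den : ℤ) ∣ u * r.num ^ (j + 2) := ⟨x (j + 2), by linarith⟩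
      have hcop : IsCoprime (r.den : ℤ) (r.num ^ (j + 2)) :=
        (r.isCoprime_num_den.symm).pow_right
      obtain ⟨v, hv⟩ := hcop.dvd_of_dvd_mul_right hd
      exact ⟨v, by rw [hu, hv]; ring⟩
  obtain ⟨k, rfl⟩ := Nat.exists_eq_add_of_le' hn
  exact key k le_rfl

/-- If `ξ` is irrational and `l > 1` is admissible in the definition of `λ_n(ξ)`, then `ξ` has
rational approximations of order `n (l + 1)` with arbitrarily large denominator. -/
lemma exists_rat_of_admissible {n : ℕ} (hn : 1 ≤ n) {ξ l : ℝ} (hξ : Irrational ξ) (hl : 1 < l)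
    (H : ∀ X₀ : ℝ, ∃ X : ℝ, X₀ ≤ X ∧ ∃ x : Fin (n + 1) → ℤ, IsSolution n ξ l X x) (Q : ℕ) :
    ∃ r : ℚ, Q < r.den ∧ |ξ - r| ≤ (r.den : ℝ) ^ (-((n : ℝ) * (l + 1))) := by
  -- Rationals of denominator at most `Q` stay at distance `δ` from the irrational `ξ`, so a closer
  -- one has a larger denominator.
  obtain ⟨δ, hδ, hδ0⟩ := (((hξ.eventually_forall_le_dist_cast_rat_of_den_le Q).filter_mono
    (nhdsWithin_le_nhds (s := Set.Ioi (0 : ℝ)))).and self_mem_nhdsWithin).exists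
  replace hδ0 : 0 < δ := hδ0
  have t1 := tendsto_rpow_neg_atTop (y := l) (by linarith)
  -- This is where `l > 1` matters: `X * X^(-l)` tends to 0, as `den_pow_dvd` demands.
  have t2 := (tendsto_rpow_neg_atTop (y := l - 1) (by linarith)).const_mul (powConst n ξ + 1)
  rw [mul_zero] at t2
  obtain ⟨X₀, hX₀⟩ := Filter.eventually_atTop.1 ((t1.eventually_lt_const hδ0).and
    ((t2.eventually_lt_const one_pos).and (Filter.eventually_ge_atTop (1 : ℝ))))
  obtain ⟨X, hX, x, hx0, hxX, hx⟩ := H X₀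
  obtain ⟨h1, h2, h3⟩ := hX₀ X hX
  have hXpos : 0 < X := by linarith
  have hx0' : x 0 ≠ 0 := by
    intro h; simp [h] at hx0
  have hxabs : (1 : ℝ) ≤ |(x 0 : ℝ)| := by exact_mod_cast Int.one_le_abs hx0'
  set y : ℕ → ℤ := fun m => if h : m < n + 1 then x ⟨m, h⟩ else 0 with hy
  have hy0 : y 0 = x 0 := by simp [hy]
  have hyx : ∀ m, 1 ≤ m → m ≤ n → |(y 0 : ℝ) * ξ ^ m - y m| ≤ X ^ (-l) := by
    intro m hm hmn
    obtain ⟨k, rfl⟩ := Nat.exists_eq_add_of_le' hm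
    have := hx ⟨k, by omega⟩
    rw [hy0]
    simpa [hy, show k < n by omega] using this
  have hdvd := den_pow_dvd (n := n) (ξ := ξ) (x := y) (ε := X ^ (-l)) (by rwa [hy0])
    (Real.rpow_le_one_of_one_le_of_nonpos h3 (by linarith)) hyx hn (by
      rw [hy0]
      refine lt_of_le_of_lt ?_ h2
      have : X ^ (-(l - 1)) = X * X ^ (-l) := by
        rw [← Real.rpow_one_add' hXpos.le (by linarith)]; congr 1; ring
      rw [this]
      have := mul_le_mul_of_nonneg_right hxX
        (mul_nonneg (add_nonneg (powConst_nonneg n ξ) zero_le_one) (Real.rpow_nonneg hXpos.le (-l)))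
      linarith)
  rw [hy0] at hdvd
  set r : ℚ := (y 1 / x 0 : ℚ) with hr
  have hrR : (r : ℝ) = y 1 / x 0 := by rw [hr]; push_cast; rfl
  have hx0R : (x 0 : ℝ) ≠ 0 := by exact_mod_cast hx0'
  have hdist : |(x 0 : ℝ)| * |ξ - r| ≤ X ^ (-l) := by
    rw [← abs_mul, hrR]
    have := hyx 1 le_rfl hn
    rwa [hy0, pow_one, show (x 0 : ℝ) * ξ - y 1 = x 0 * (ξ - y 1 / x 0) by field_simp] at this
  have hden1 : (1 : ℝ) ≤ r.den := by exact_mod_cast r.pos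
  have hdenle : (r.den : ℝ) ^ n ≤ |(x 0 : ℝ)| := by
    have := Int.le_of_dvd (abs_pos.2 hx0') ((dvd_abs _ _).2 hdvd)
    exact_mod_cast this
  refine ⟨r, ?_, ?_⟩
  · by_contra! hQ
    have := hδ r hQ
    rw [Real.dist_eq] at this
    nlinarith [abs_nonneg (ξ - r)]
  · have hxpos : 0 < |(x 0 : ℝ)| := hx0
    have hstep : |ξ - r| ≤ |(x 0 : ℝ)| ^ (-(l + 1)) := by
      have e : |(x 0 : ℝ)| ^ (-(l + 1)) = |(x 0 : ℝ)|⁻¹ * |(x 0 : ℝ)| ^ (-l) := by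
        rw [← Real.rpow_neg_one, ← Real.rpow_add hxpos]; congr 1; ring
      rw [e, le_inv_mul_iff₀ hxpos]
      exact hdist.trans (Real.rpow_le_rpow_of_nonpos hxpos hxX (by linarith))
    refine hstep.trans ?_
    calc |(x 0 : ℝ)| ^ (-(l + 1)) ≤ ((r.den : ℝ) ^ n) ^ (-(l + 1)) :=
          Real.rpow_le_rpow_of_nonpos (by positivity) hdenle (by linarith)
      _ = _ := by
        rw [← Real.rpow_natCast, ← Real.rpow_mul (by positivity)]; congr 1; ring

/-! ### Lacunary ternary numbers -/

/-- Exponents with `a_{k+1} = ⌈c a_k⌉`. -/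
noncomputable def expSeq (c : ℝ) : ℕ → ℕ
  | 0 => 1
  | k + 1 => ⌈c * expSeq c k⌉₊

lemma expSeq_succ_ge (c : ℝ) (k : ℕ) : c * expSeq c k ≤ expSeq c (k + 1) := Nat.le_ceil _

lemma expSeq_succ_le {c : ℝ} (hc : 0 ≤ c) (k : ℕ) :
    (expSeq c (k + 1) : ℝ) ≤ c * expSeq c k + 1 := (Nat.ceil_lt_add_one (by positivity)).le

lemma three_mul_expSeq_le {c : ℝ} (hc : 3 ≤ c) (k : ℕ) :
    3 * expSeq c k ≤ expSeq c (k + 1) := by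
  have h := expSeq_succ_ge c k
  have : (3 : ℝ) * expSeq c k ≤ expSeq c (k + 1) :=
    (mul_le_mul_of_nonneg_right hc (Nat.cast_nonneg _)).trans h
  exact_mod_cast this

lemma lt_expSeq {c : ℝ} (hc : 3 ≤ c) (k : ℕ) : k < expSeq c k := by
  induction k with
  | zero => simp [expSeq]
  | succ k ih => have := three_mul_expSeq_le hc k; omega

lemma expSeq_strictMono {c : ℝ} (hc : 3 ≤ c) : StrictMono (expSeq c) :=
  strictMono_nat_of_lt_succ fun k => by
    have := three_mul_expSeq_le hc k
    have := lt_expSeq hc k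
    omega

/-- A ternary digit `1` or `2`. -/
def digit (b : Bool) : ℕ := if b then 2 else 1

lemma one_le_digit (b : Bool) : 1 ≤ digit b := by cases b <;> simp [digit]

lemma digit_le_two (b : Bool) : digit b ≤ 2 := by cases b <;> simp [digit]

/-- The `k`-th term of the lacunary series. -/
noncomputable def term (c : ℝ) (b : ℕ → Bool) (k : ℕ) : ℝ := digit (b k) * (1 / 3 : ℝ) ^ expSeq c k

/-- The lacunary ternary number with nonzero digits `b` at the places `expSeq c`. -/
noncomputable def lacunary (c : ℝ) (b : ℕ → Bool) : ℝ := ∑' k, term c b k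

/-- Numerator of the `k`-th truncation over the denominator `3 ^ expSeq c k`. -/
noncomputable def numer (c : ℝ) (b : ℕ → Bool) : ℕ → ℤ
  | 0 => digit (b 0)
  | k + 1 => 3 ^ (expSeq c (k + 1) - expSeq c k) * numer c b k + digit (b (k + 1))

lemma sum_term_eq {c : ℝ} (hc : 3 ≤ c) (b : ℕ → Bool) (k : ℕ) :
    ∑ i ∈ Finset.range (k + 1), term c b i = numer c b k / 3 ^ expSeq c k := by
  induction k with
  | zero => simp [term, numer, div_eq_mul_inv]
  | succ k ih =>
    have hlt := expSeq_strictMono hc (Nat.lt_succ_self k)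
    obtain ⟨d, hd⟩ := Nat.exists_eq_add_of_lt hlt
    rw [Finset.sum_range_succ, ih, term, numer]
    simp only [Nat.succ_eq_add_one] at hd
    rw [hd, show expSeq c k + d + 1 - expSeq c k = d + 1 by omega]
    push_cast
    rw [one_div, inv_pow]
    field_simp
    ring

/-- The last ternary digit of the numerator is 1 or 2, so the truncation is in lowest terms. -/
lemma isCoprime_numer {c : ℝ} (hc : 3 ≤ c) (b : ℕ → Bool) (k j : ℕ) :
    IsCoprime (3 ^ j : ℤ) (numer c b k) := by
  have hdig : ∀ t : Bool, IsCoprime (3 : ℤ) (digit t) := by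
    intro t
    cases t
    · exact ⟨0, 1, by simp [digit]⟩
    · exact ⟨1, -1, by simp [digit]⟩
  refine IsCoprime.pow_left ?_
  cases k with
  | zero => exact hdig _
  | succ k =>
    have hlt := expSeq_strictMono hc (Nat.lt_succ_self k)
    obtain ⟨d, hd⟩ := Nat.exists_eq_add_of_lt hlt
    simp only [Nat.succ_eq_add_one] at hd
    rw [numer, hd, show expSeq c k + d + 1 - expSeq c k = d + 1 by omega, pow_succ', mul_assoc]
    exact (IsCoprime.mul_add_left_right_iff).2 (hdig _)

lemma term_nonneg (c : ℝ) (b : ℕ → Bool) (k : ℕ) : 0 ≤ term c b k := by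
  unfold term; positivity

lemma term_add_le {c : ℝ} (hc : 3 ≤ c) (b : ℕ → Bool) (k i : ℕ) :
    term c b (i + k) ≤ 2 * (1 / 3 : ℝ) ^ expSeq c k * (1 / 3 : ℝ) ^ i := by
  have h : expSeq c k + i ≤ expSeq c (i + k) := by
    have := (expSeq_strictMono hc).add_le_nat i k
    omega
  rw [mul_assoc, ← pow_add]
  unfold term
  have : (digit (b (i + k)) : ℝ) ≤ 2 := by exact_mod_cast digit_le_two _
  exact mul_le_mul this (pow_le_pow_of_le_one (by norm_num) (by norm_num) h)
    (by positivity) (by norm_num)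

lemma summable_term {c : ℝ} (hc : 3 ≤ c) (b : ℕ → Bool) : Summable (term c b) :=
  Summable.of_nonneg_of_le (term_nonneg c b) (term_add_le hc b 0)
    ((summable_geometric_of_lt_one (by norm_num) (by norm_num)).mul_left _)

lemma lacunary_sub_eq {c : ℝ} (hc : 3 ≤ c) (b : ℕ → Bool) (k : ℕ) :
    lacunary c b - ∑ i ∈ Finset.range k, term c b i = ∑' i, term c b (i + k) := by
  rw [lacunary, ← (summable_term hc b).sum_add_tsum_nat_add k]; ring

lemma le_lacunary_sub {c : ℝ} (hc : 3 ≤ c) (b : ℕ → Bool) (k : ℕ) :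
    (1 / 3 : ℝ) ^ expSeq c k ≤ lacunary c b - ∑ i ∈ Finset.range k, term c b i := by
  rw [lacunary_sub_eq hc]
  have h := ((summable_nat_add_iff k).2 (summable_term hc b)).le_tsum 0
    fun i _ => term_nonneg c b _
  refine le_trans ?_ h
  have : (1 : ℝ) ≤ digit (b (0 + k)) := by exact_mod_cast one_le_digit _
  unfold term
  rw [zero_add] at *
  exact le_mul_of_one_le_left (by positivity) this

lemma lacunary_sub_le {c : ℝ} (hc : 3 ≤ c) (b : ℕ → Bool) (k : ℕ) :
    lacunary c b - ∑ i ∈ Finset.range k, term c b i ≤ 3 * (1 / 3 : ℝ) ^ expSeq c k := by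
  rw [lacunary_sub_eq hc]
  have hs := (summable_geometric_of_lt_one (r := (1 / 3 : ℝ)) (by norm_num) (by norm_num))
  have h := ((summable_nat_add_iff k).2 (summable_term hc b)).tsum_le_tsum
    (term_add_le hc b k) (hs.mul_left _)
  refine h.trans (le_of_eq ?_)
  rw [tsum_mul_left, tsum_geometric_of_lt_one (by norm_num) (by norm_num)]
  ring

/-- At the first differing digit the terms differ by exactly `3^(-a_k)`. Both tails lie between `T`
and `3T` with `T ≤ 3^(-a_k) / 3`, so they cannot compensate. -/
lemma lacunary_injective {c : ℝ} (hc : 3 ≤ c) : Function.Injective (lacunary c) := by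
  intro b b' h
  by_contra hne
  have hex : ∃ k, b k ≠ b' k := Function.ne_iff.1 hne
  classical
  set k := Nat.find hex with hk
  have hk1 : b k ≠ b' k := Nat.find_spec hex
  have hlow : ∑ i ∈ Finset.range k, term c b i = ∑ i ∈ Finset.range k, term c b' i := by
    refine Finset.sum_congr rfl fun i hi => ?_
    have := Nat.find_min hex (Finset.mem_range.1 hi)
    rw [term, term, not_not.1 this]
  have e1 := le_lacunary_sub hc b (k + 1)
  have e2 := lacunary_sub_le hc b (k + 1)
  have e3 := le_lacunary_sub hc b' (k + 1)
  have e4 := lacunary_sub_le hc b' (k + 1)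
  rw [Finset.sum_range_succ] at e1 e2 e3 e4
  have hT : (1 / 3 : ℝ) ^ expSeq c (k + 1) ≤ (1 / 3) * (1 / 3 : ℝ) ^ expSeq c k := by
    rw [← pow_succ']
    exact pow_le_pow_of_le_one (by norm_num) (by norm_num)
      (expSeq_strictMono hc (Nat.lt_succ_self k))
  have hT0 : 0 < (1 / 3 : ℝ) ^ expSeq c k := by positivity
  have hd : term c b k - term c b' k = (1 / 3 : ℝ) ^ expSeq c k ∨
      term c b' k - term c b k = (1 / 3 : ℝ) ^ expSeq c k := by
    unfold term
    rcases hb : b k <;> rcases hb' : b' k <;> simp_all [digit] <;> ring_nf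
  rcases hd with hd | hd <;> linarith

/-- Algebraic numbers are countable, whereas digit sequences are not, by Cantor's diagonal argument.
-/
lemma exists_transcendental_lacunary {c : ℝ} (hc : 3 ≤ c) :
    ∃ b, Transcendental ℚ (lacunary c b) := by
  by_contra! h
  have hcount : (Set.range (lacunary c)).Countable :=
    (Algebraic.countable ℚ ℝ).mono (by
      rintro _ ⟨b, rfl⟩
      exact not_not.1 (h b))
  have : Countable (ℕ → Bool) :=
    (Set.countable_coe_iff.2 hcount).of_equiv _ (Equiv.ofInjective _ (lacunary_injective hc)).symm
  obtain ⟨g, hg⟩ := exists_surjective_nat (ℕ → Bool)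
  obtain ⟨i, hi⟩ := hg fun j => !g j j
  simpa using congrFun hi i

/-! ### Irrationality exponent of lacunary numbers -/

/-- The irrationality exponent of `lacunary c b` is at most `c`. -/
lemma lacunary_rat_bound {c s : ℝ} (hc : 3 ≤ c) (hs : c < s) (b : ℕ → Bool) :
    ∃ Q : ℕ, ∀ r : ℚ, Q < r.den → (r.den : ℝ) ^ (-s) < |lacunary c b - r| := by
  obtain ⟨K, hK⟩ := exists_nat_gt (1 / (s - c))
  set a := expSeq c with ha
  have hmono : StrictMono a := expSeq_strictMono hc
  refine ⟨3 ^ a (K + 7), fun r hr => ?_⟩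
  by_contra! hle
  set q := r.den with hq
  have hq0 : (0 : ℝ) < q := by exact_mod_cast r.pos
  have hq1 : (1 : ℝ) ≤ q := by exact_mod_cast r.pos
  -- The first such `k` selects the truncation to compare with `r`. The factor 9 makes the tail, at
  -- most `3 / 3^(a (k+1))`, at most a third of `1 / (q 3^(a k))`.
  have hex : ∃ k, 9 * q * 3 ^ a k < 3 ^ a (k + 1) := by
    refine ⟨q + 2, ?_⟩
    have h3 := three_mul_expSeq_le hc (q + 2)
    have h4 := lt_expSeq hc (q + 2)
    rw [← ha] at h3 h4
    calc 9 * q * 3 ^ a (q + 2) < 3 ^ 2 * 3 ^ q * 3 ^ a (q + 2) := by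
          have := Nat.lt_pow_self (n := q) (a := 3) (by norm_num)
          exact Nat.mul_lt_mul_of_pos_right (by omega) (by positivity)
      _ = 3 ^ (2 + q + a (q + 2)) := by rw [pow_add, pow_add]
      _ ≤ _ := Nat.pow_le_pow_right (by norm_num) (by omega)
  classical
  set k := Nat.find hex with hk
  have hk1 : 9 * q * 3 ^ a k < 3 ^ a (k + 1) := Nat.find_spec hex
  -- A large `k` has a predecessor `j`, makes `a k (s - c) > 1`, and gives `a j > 5` for the last
  -- step.
  have hkK : K + 6 < k := by
    have : 3 ^ a (K + 7) < 3 ^ a (k + 1) := by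
      refine lt_of_lt_of_le hr (le_trans ?_ hk1.le)
      nlinarith [Nat.one_le_pow (a k) 3 (by norm_num)]
    have := hmono.lt_iff_lt.1 ((Nat.pow_lt_pow_iff_right (by norm_num)).1 this)
    omega
  obtain ⟨j, hj⟩ : ∃ j, k = j + 1 := ⟨k - 1, by omega⟩
  have hk2 : 3 ^ a (j + 1) ≤ 9 * q * 3 ^ a j := by
    have := Nat.find_min hex (m := j) (by omega)
    exact not_lt.1 this
  rw [hj] at hk1 hkK
  have hlow := le_lacunary_sub hc b (j + 1 + 1)
  have hup := lacunary_sub_le hc b (j + 1 + 1)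
  rw [sum_term_eq hc] at hlow hup
  rw [← ha, one_div, inv_pow] at hlow hup
  set P := numer c b (j + 1) with hP
  have hrR : (r : ℝ) = r.num / q := by exact_mod_cast (Rat.num_div_den r).symm
  -- If `r` is the truncation itself, then `q ≥ 3^(a k)`, while the tail is at least `3^(-(c * a k +
  -- 1))`: too large for order `s > c`.
  by_cases hcase : r.num * 3 ^ a (j + 1) = P * q
  · have hrS : (r : ℝ) = P / 3 ^ a (j + 1) := by
      rw [hrR, div_eq_div_iff hq0.ne' (by positivity)]
      exact_mod_cast hcase
    have hdvd : (3 : ℤ) ^ a (j + 1) ∣ q :=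
      (isCoprime_numer hc b (j + 1) (a (j + 1))).dvd_of_dvd_mul_left ⟨r.num, by linarith⟩
    have hqge : (3 : ℝ) ^ a (j + 1) ≤ q := by
      have := Int.le_of_dvd (by exact_mod_cast r.pos) hdvd
      exact_mod_cast this
    rw [hrS] at hle
    have h1 : ((3 : ℝ) ^ a (j + 1 + 1))⁻¹ ≤ ((3 : ℝ) ^ a (j + 1)) ^ (-s) :=
      (hlow.trans (le_abs_self _)).trans
        (hle.trans (Real.rpow_le_rpow_of_nonpos (by positivity) hqge (by linarith)))
    rw [← Real.rpow_natCast, ← Real.rpow_natCast, ← Real.rpow_neg (by norm_num),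
      ← Real.rpow_mul (by norm_num), Real.rpow_le_rpow_left_iff (by norm_num)] at h1
    have h2 := expSeq_succ_le (c := c) (by linarith) (j + 1)
    rw [← ha] at h2
    have h3 : (K : ℝ) ≤ a (j + 1) := by
      have := lt_expSeq hc (j + 1)
      rw [← ha] at this
      exact_mod_cast (by omega : K ≤ a (j + 1))
    have h4 : 1 < K * (s - c) := (div_lt_iff₀ (by linarith)).1 hK
    nlinarith
  -- Otherwise the two fractions are at least `1 / (q 3^(a k))` apart, and the tail removes at most
  -- a third of that. As `s > 3`, this yields `q^2 ≤ 3 * 3^(a k)`.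
  · have hdiff : 1 / (q * (3 : ℝ) ^ a (j + 1)) ≤ |(r : ℝ) - P / 3 ^ a (j + 1)| := by
      rw [hrR, div_sub_div _ _ hq0.ne' (by positivity), abs_div,
        abs_of_pos (by positivity : (0 : ℝ) < q * 3 ^ a (j + 1))]
      gcongr
      have := Int.one_le_abs (sub_ne_zero.2 hcase)
      have h : ((1 : ℤ) : ℝ) ≤ ((|r.num * 3 ^ a (j + 1) - P * q| : ℤ) : ℝ) := by
        exact_mod_cast this
      push_cast at h
      rwa [mul_comm (q : ℝ)]
    have hk1R : 9 * (q : ℝ) * 3 ^ a (j + 1) ≤ 3 ^ a (j + 1 + 1) := by exact_mod_cast hk1.le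
    have hsmall : 3 * ((3 : ℝ) ^ a (j + 1 + 1))⁻¹ ≤ (1 / 3) * (1 / (q * (3 : ℝ) ^ a (j + 1))) := by
      have := inv_anti₀ (by positivity) hk1R
      calc _ ≤ 3 * (9 * (q : ℝ) * 3 ^ a (j + 1))⁻¹ := by gcongr
        _ = _ := by field_simp; norm_num
    have hdist : 1 / (3 * (q * (3 : ℝ) ^ a (j + 1))) ≤ |lacunary c b - r| := by
      have htri := abs_sub_le (r : ℝ) (lacunary c b) (P / 3 ^ a (j + 1))
      rw [abs_sub_comm (r : ℝ) (lacunary c b)] at htri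
      have hnn : 0 ≤ lacunary c b - P / 3 ^ a (j + 1) := le_trans (by positivity) hlow
      rw [abs_of_nonneg hnn] at htri
      have hpos : 0 < 1 / (q * (3 : ℝ) ^ a (j + 1)) := by positivity
      have e : 1 / (3 * (q * (3 : ℝ) ^ a (j + 1))) = (1 / 3) * (1 / (q * (3 : ℝ) ^ a (j + 1))) := by
        field_simp
      linarith
    have hq3 : (q : ℝ) ^ (-s) ≤ 1 / (q : ℝ) ^ 3 := by
      rw [one_div, ← Real.rpow_natCast, ← Real.rpow_neg hq0.le]
      exact Real.rpow_le_rpow_of_exponent_le hq1 (by push_cast; linarith)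
    have hqq : (q : ℝ) ^ 2 ≤ 3 * 3 ^ a (j + 1) := by
      have := (hdist.trans hle).trans hq3
      rw [div_le_div_iff₀ (by positivity) (by positivity)] at this
      nlinarith
    have hqqN : q ^ 2 ≤ 3 * 3 ^ a (j + 1) := by exact_mod_cast hqq
    -- Minimality of `k` now gives `a k ≤ 5 + 2 a j`, against `a k ≥ 3 a j` and `a j > 5`.
    have hfin : 3 ^ (2 * a (j + 1)) ≤ 3 ^ (5 + a (j + 1) + 2 * a j) := by
      calc 3 ^ (2 * a (j + 1)) = (3 ^ a (j + 1)) ^ 2 := by rw [mul_comm, pow_mul]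
        _ ≤ (9 * q * 3 ^ a j) ^ 2 := Nat.pow_le_pow_left hk2 2
        _ = 81 * (3 ^ a j) ^ 2 * q ^ 2 := by ring
        _ ≤ 81 * (3 ^ a j) ^ 2 * (3 * 3 ^ a (j + 1)) := by gcongr
        _ = _ := by rw [pow_add, pow_add, mul_comm 2 (a j), pow_mul]; ring
    have h1 := (Nat.pow_le_pow_iff_right (by norm_num)).1 hfin
    have h2 := three_mul_expSeq_le hc j
    have h3 := lt_expSeq hc j
    rw [← ha] at h2 h3
    omega

lemma lacunary_approx {c : ℝ} (hc : 3 ≤ c) (b : ℕ → Bool) (Q : ℕ) :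
    ∃ q : ℕ, Q ≤ q ∧ ∃ p : ℤ, |lacunary c b - p / q| ≤ 3 * (q : ℝ) ^ (-c) := by
  refine ⟨3 ^ expSeq c Q, ?_, numer c b Q, ?_⟩
  · exact (lt_expSeq hc Q).le.trans (Nat.lt_pow_self (by norm_num)).le
  · have hlow := le_lacunary_sub hc b (Q + 1)
    have hup := lacunary_sub_le hc b (Q + 1)
    rw [sum_term_eq hc] at hlow hup
    push_cast
    rw [abs_of_nonneg (le_trans (by positivity) hlow)]
    refine hup.trans ?_
    gcongr
    rw [one_div, inv_pow, ← Real.rpow_natCast, ← Real.rpow_natCast,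
      ← Real.rpow_neg (by norm_num), ← Real.rpow_mul (by norm_num),
      Real.rpow_le_rpow_left_iff (by norm_num)]
    linarith [expSeq_succ_ge c Q]

/-! ### Values of `λ_n` -/

lemma lambdaExp_lacunary {n : ℕ} (hn : 1 ≤ n) {l : ℝ} (hl : 1 < l) (hc : 3 ≤ n * (l + 1))
    {b : ℕ → Bool} (hirr : Irrational (lacunary (n * (l + 1)) b)) :
    lambdaExp n (lacunary (n * (l + 1)) b) = l := by
  refine le_antisymm (sSup_le ?_) (le_lambdaExp hn (by linarith) (lacunary_approx hc b))
  rintro _ ⟨l', rfl, H⟩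
  by_contra! hlt
  replace hlt : l < l' := by exact_mod_cast hlt
  have hnR : (1 : ℝ) ≤ n := by exact_mod_cast hn
  have hs : n * (l + 1) < n * (l' + 1) := by nlinarith
  obtain ⟨Q, hQ⟩ := lacunary_rat_bound hc hs b
  obtain ⟨r, hr, hle⟩ := exists_rat_of_admissible hn hirr (hl.trans hlt) H Q
  exact absurd hle (not_le.2 (hQ r hr))

lemma lambdaExp_of_liouville {n : ℕ} (hn : 1 ≤ n) {ξ : ℝ} (hξ : Liouville ξ) :
    lambdaExp n ξ = ⊤ := by
  rw [EReal.eq_top_iff_forall_lt]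
  intro y
  obtain ⟨N, hN⟩ := exists_nat_gt (max y 0)
  have hyN : y < N := (le_max_left _ _).trans_lt hN
  have hN0 : (0 : ℝ) < N := (le_max_right _ _).trans_lt hN
  refine lt_of_lt_of_le (by exact_mod_cast hyN)
    (le_lambdaExp (l := N) (K := 1) hn hN0 fun Q => ?_)
  obtain ⟨q, hq, p, -, hp⟩ :=
    Filter.frequently_atTop.1 (hξ.frequently_exists_num (n * (N + 1))) Q
  refine ⟨q, hq, p, hp.le.trans (le_of_eq ?_)⟩
  rw [one_mul, Real.rpow_neg (by positivity), one_div, ← Real.rpow_natCast]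
  push_cast
  rfl

end SimultApprox

theorem theorem10 (n : ℕ) (hn : 1 ≤ n) :
    Set.Ioc (((3 + Real.sqrt (4 * (n : ℝ) ^ 2 + 1)) / (2 * (n : ℝ)) : ℝ) : EReal) ⊤ ⊆
      SimultApprox.lambdaSpectrum n := by
  rintro L ⟨hL, -⟩
  have hnR : (1 : ℝ) ≤ n := by exact_mod_cast hn
  induction L with
  | bot => simp at hL
  | top =>
    have hξ := liouville_liouvilleNumber (m := 2) le_rfl
    exact ⟨_, (IsFractionRing.isAlgebraic_iff ℤ ℚ ℝ).not.1 hξ.transcendental,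
       SimultApprox.lambdaExp_of_liouville hn hξ⟩
  | coe l =>
    replace hL : (3 + Real.sqrt (4 * (n : ℝ) ^ 2 + 1)) / (2 * (n : ℝ)) < l := by
      exact_mod_cast hL
    rw [div_lt_iff₀ (by linarith)] at hL
    -- Bounding the root below by `2n` gives `l > 1 + 3 / (2n)`, which yields both `l > 1` and `n (l
    -- + 1) ≥ 3`.
    have hsqrt : 2 * (n : ℝ) ≤ Real.sqrt (4 * (n : ℝ) ^ 2 + 1) :=
      Real.le_sqrt_of_sq_le (by nlinarith)
    have hl : 1 < l := by nlinarith
    have hc : 3 ≤ n * (l + 1) := by nlinarith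
    obtain ⟨b, hb⟩ := SimultApprox.exists_transcendental_lacunary hc
    exact ⟨_, hb, SimultApprox.lambdaExp_lacunary hn hl hc hb.irrational⟩
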